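/- Let $\mathbb{S}^1=\mathbb{R}/\mathbb{Z}$ and let $\mathscr{S}'(\mathbb{S}^1)$ be the space of (complex) distributions on $\mathbb{S}^1$, i.e. the topological dual of $C^\infty(\mathbb{S}^1)$. For $f\in\mathscr{S}'(\mathbb{S}^1)$ put $\widehat f(n)=\langle f,e^{-2\pi i n x}\rangle$, $n\in\mathbb{Z}$, and let $f^{\mathrm{PER}}\in\mathscr{S}'(\mathbb{R})$ be the $1$-periodic extension of $f$, i.e. $\langle f^{\mathrm{PER}},\psi\rangle=\langle f,\sum_{n\in\mathbb{Z}}\psi(\cdot+n)\rangle$ for $\psi\in\mathscr{S}(\mathbb{R})$. Let $\varphi_0\in\mathscr{S}(\mathbb{R})$ be real valued with $\varphi_0(x)=1$ for $|x|\le 1$ and $\varphi_0(x)=0$ for $|x|\ge 3/2$, and let $\varphi_j(x)=\varphi_0(2^{-j}x)-\varphi_0(2^{-j+1}x)$ for $j\ge 1$. For $s\in\mathbb{R}$, $F\in\mathscr{S}'(\mathbb{R})$ and $f\in\mathscr{S}'(\mathbb{S}^1)$ define, with values in $[0,\infty]$, $$\|F\|_{\infty,\infty,s}=\sup_{j\ge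 0}2^{js}\operatorname*{ess\,sup}_{x\in\mathbb{R}}\bigl|(\varphi_j\widehat F)^{\vee}(x)\bigr|,\qquad \|f\|_{\infty,\infty,s}=\sup_{j\ge 0}2^{js}\operatorname*{ess\,sup}_{x\in\mathbb{R}}\Bigl|\sum_{n\in\mathbb{Z}}\varphi_j(n)\widehat f(n)e^{2\pi i n x}\Bigr|,$$ where $\widehat{\ }$ is the Fourier transform on $\mathscr{S}'(\mathbb{R})$ that extends $\widehat\psi(\xi)=\int_{\mathbb{R}}\psi(x)e^{-2\pi i x\xi}\,dx$, ${}^\vee$ is its inverse, and the essential supremum of a distribution that is not an $L^\infty$ function is $\infty$. Let $\mathscr{B}^s_{\infty,\infty}(\mathbb{R})$ and $\mathscr{B}^s_{\infty,\infty}(\mathbb{S}^1)$ be the sets of those $F$, respectively $f$, for which the quasi-norm is finite. Then, for every such $\varphi_0$, every $s\in\mathbb{R}$ and every $f\in\mathscr{S}'(\mathbb{S}^1)$, $$\|f^{\mathrm{PER}}\|_{\infty,\infty,s}=\|f\|_{\infty,\infty,s};$$ in particular, $f^{\mathrm{PER}}\in\mathscr{B}^s_{\infty,\infty}(\mathbb{R})$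 if and only if $f\in\mathscr{B}^s_{\infty,\infty}(\mathbb{S}^1)$. -/

import Mathlib

open scoped SchwartzMap FourierTransform ContDiff ENNReal
open MeasureTheory

/-! ### Distributions on the circle `𝕊¹ = ℝ / ℤ` -/

/-- The smooth functions on the circle `ℝ / ℤ`: the functions `g` on `ℝ / ℤ` such that
`x ↦ g (x mod 1)` is infinitely differentiable on `ℝ`. -/
def smoothCircleSubmodule : Submodule ℂ (UnitAddCircle → ℂ) where
  carrier := {g | ContDiff ℝ ∞ (fun x : ℝ ↦ g (x : UnitAddCircle))}
  add_mem' {g h} hg hh := by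
    change ContDiff ℝ ∞ fun x : ℝ ↦ g (x : UnitAddCircle) + h (x : UnitAddCircle)
    exact ContDiff.add hg hh
  zero_mem' := by
    change ContDiff ℝ ∞ fun _ : ℝ ↦ (0 : ℂ)
    exact contDiff_const
  smul_mem' c g hg := by
    change ContDiff ℝ ∞ fun x : ℝ ↦ c • g (x : UnitAddCircle)
    exact ContDiff.const_smul c hg

/-- The space `C^∞(𝕊¹)` of test functions on the circle. -/
def SmoothCircle : Type := smoothCircleSubmodule

theorem contDiff_fourier (n : ℤ) : ContDiff ℝ ∞ fun x : ℝ ↦ fourier n (x : UnitAddCircle) := by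
  simp only [fourier_coe_apply]
  have h : ContDiff ℝ ∞ fun x : ℝ ↦ (x : ℂ) := Complex.ofRealCLM.contDiff
  fun_prop

namespace SmoothCircle

noncomputable instance : AddCommGroup SmoothCircle :=
  inferInstanceAs (AddCommGroup smoothCircleSubmodule)

noncomputable instance : Module ℂ SmoothCircle :=
  inferInstanceAs (Module ℂ smoothCircleSubmodule)

instance : CoeFun SmoothCircle (fun _ ↦ UnitAddCircle → ℂ) := ⟨fun g ↦ g.1⟩

theorem ext_fun {g h : SmoothCircle} (H : ∀ x : ℝ, g x = h x) : g = h := by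
  apply Subtype.ext
  funext z
  induction z using QuotientAddGroup.induction_on with
  | H x => exact H x

/-- The lift of a test function on the circle to a (1-periodic) function on the line. -/
def lift (g : SmoothCircle) : ℝ → ℂ := fun x ↦ g (x : UnitAddCircle)

theorem contDiff_lift (g : SmoothCircle) : ContDiff ℝ ∞ g.lift := g.2

theorem periodic_iteratedDeriv_lift (g : SmoothCircle) (k : ℕ) :
    Function.Periodic (iteratedDeriv k g.lift) 1 := by
  induction k with
  | zero =>
    intro x
    simp [lift]
  | succ k ih =>
    intro x
    rw [iteratedDeriv_succ, ← deriv_comp_add_const]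
    congr 1
    exact funext ih

theorem bddAbove_iteratedDeriv_lift (g : SmoothCircle) (k : ℕ) :
    BddAbove (Set.range fun x : ℝ ↦ ‖iteratedDeriv k g.lift x‖) := by
  have hc : Continuous (iteratedDeriv k g.lift) :=
    g.contDiff_lift.continuous_iteratedDeriv k (by exact_mod_cast le_top)
  obtain ⟨C, hC⟩ := (isCompact_Icc (a := (0 : ℝ)) (b := 1)).exists_bound_of_continuousOn
    hc.continuousOn
  refine ⟨C, ?_⟩
  rintro _ ⟨x, rfl⟩
  obtain ⟨y, hy, hxy⟩ := (g.periodic_iteratedDeriv_lift k).exists_mem_Ico₀ one_pos x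
  simp only [hxy]
  exact hC y ⟨hy.1, hy.2.le⟩

/-- The seminorm `g ↦ sup_x |g^{(k)}(x)|` on `C^∞(𝕊¹)`. -/
noncomputable def derivSeminorm (k : ℕ) : Seminorm ℂ SmoothCircle :=
  Seminorm.of (fun g ↦ ⨆ x : ℝ, ‖iteratedDeriv k g.lift x‖)
    (by
      intro g h
      refine ciSup_le fun x ↦ ?_
      have e : iteratedDeriv k (g + h).lift x
          = iteratedDeriv k g.lift x + iteratedDeriv k h.lift x :=
        iteratedDeriv_add
          (g.contDiff_lift.contDiffAt.of_le (by exact_mod_cast le_top))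
          (h.contDiff_lift.contDiffAt.of_le (by exact_mod_cast le_top))
      rw [e]
      exact (norm_add_le _ _).trans (add_le_add
        (le_ciSup (g.bddAbove_iteratedDeriv_lift k) x)
        (le_ciSup (h.bddAbove_iteratedDeriv_lift k) x)))
    (by
      intro c g
      rw [Real.mul_iSup_of_nonneg (norm_nonneg c)]
      congr 1
      funext x
      have e : iteratedDeriv k (c • g).lift x = c • iteratedDeriv k g.lift x :=
        iteratedDeriv_const_smul_field c g.lift
      rw [e, norm_smul])

/-- The Fréchet topology of `C^∞(𝕊¹)`: uniform convergence of all derivatives. -/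
noncomputable instance : TopologicalSpace SmoothCircle :=
  SeminormFamily.moduleFilterBasis (𝕜 := ℂ) derivSeminorm |>.topology

theorem withSeminorms_derivSeminorm : WithSeminorms derivSeminorm := ⟨rfl⟩

/-- The character `x ↦ e^{2πinx}`, as a test function on the circle. -/
noncomputable def char (n : ℤ) : SmoothCircle :=
  ⟨fun z ↦ fourier n z, contDiff_fourier n⟩

end SmoothCircle

/-- The space `𝓢'(𝕊¹)` of distributions on the circle, the topological dual of `C^∞(𝕊¹)`. -/
abbrev CircleDistribution : Type := SmoothCircle →L[ℂ] ℂ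

/-- The Fourier coefficient `f̂(n) = ⟨f, e^{-2πinx}⟩` of a distribution on the circle. -/
noncomputable def circleFourierCoeff (f : CircleDistribution) (n : ℤ) : ℂ :=
  f (SmoothCircle.char (-n))

/-! ### The 1-periodic extension of a distribution on the circle -/

section Periodization

theorem periodic_tsum_schwartz (ψ : 𝓢(ℝ, ℂ)) :
    Function.Periodic (fun x : ℝ ↦ ∑' n : ℤ, ψ (x + n)) 1 := by
  intro x
  simp only
  rw [← (Equiv.addRight (1 : ℤ)).tsum_eq (fun n : ℤ ↦ ψ (x + n))]
  refine tsum_congr fun n ↦ ?_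
  simp only [Equiv.coe_addRight, Int.cast_add, Int.cast_one]
  congr 1
  ring

theorem norm_iteratedDeriv_fourier_term (a : ℂ) (n : ℤ) (k : ℕ) (x : ℝ) :
    ‖iteratedDeriv k (fun y : ℝ ↦ a * fourier n (y : UnitAddCircle)) x‖
      = ‖a‖ * (2 * Real.pi * |(n : ℝ)|) ^ k := by
  have key : iteratedDeriv k (fun y : ℝ ↦ a * fourier n (y : UnitAddCircle))
      = fun y : ℝ ↦ (a * (2 * Real.pi * Complex.I * n) ^ k) *
          fourier n (y : UnitAddCircle) := by
    induction k with
    | zero => simp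
    | succ k ih =>
      rw [iteratedDeriv_succ, ih]
      funext y
      have h := (hasDerivAt_fourier 1 n y).const_mul (a * (2 * Real.pi * Complex.I * n) ^ k)
      rw [h.deriv]
      push_cast
      ring
  rw [key, norm_mul, fourier_apply, Circle.norm_coe]
  simp [abs_of_pos Real.pi_pos]

theorem summable_fourier_bound (k : ℕ) :
    Summable fun n : ℤ ↦ (2 * Real.pi) ^ k * (2 * (1 + |(n : ℝ)| ^ 2)⁻¹) := by
  refine Summable.mul_left _ (Summable.mul_left _ ?_)
  refine Summable.of_nonneg_of_le (fun n ↦ by positivity) (fun n ↦ ?_)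
    (f := fun n : ℤ ↦ if n = 0 then (1 : ℝ) else 1 / (n : ℝ) ^ 2) ?_
  · split_ifs with h
    · simp [h]
    · have : (n : ℝ) ≠ 0 := by exact_mod_cast h
      rw [sq_abs, ← one_div]
      exact one_div_le_one_div_of_le (by positivity) (by linarith)
  · have h1 := (Real.summable_one_div_int_pow (p := 2)).2 (by norm_num)
    refine (summable_congr_cofinite ?_).1 h1
    filter_upwards [(Set.finite_singleton (0 : ℤ)).compl_mem_cofinite] with n hn
    rw [if_neg (by simpa using hn)]

theorem fourier_term_le (h : 𝓢(ℝ, ℂ)) (k : ℕ) (n : ℤ) :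
    ‖h n‖ * (2 * Real.pi * |(n : ℝ)|) ^ k ≤
      (SchwartzMap.seminorm ℂ k 0 h + SchwartzMap.seminorm ℂ (k + 2) 0 h) *
        ((2 * Real.pi) ^ k * (2 * (1 + |(n : ℝ)| ^ 2)⁻¹)) := by
  have h0 := SchwartzMap.norm_pow_mul_le_seminorm ℂ h k (n : ℝ)
  have h2 := SchwartzMap.norm_pow_mul_le_seminorm ℂ h (k + 2) (n : ℝ)
  rw [Real.norm_eq_abs] at h0 h2
  have hA : |(n : ℝ)| ^ k * ‖h n‖ * (1 + |(n : ℝ)| ^ 2) ≤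
      SchwartzMap.seminorm ℂ k 0 h + SchwartzMap.seminorm ℂ (k + 2) 0 h := by
    have e : |(n : ℝ)| ^ k * ‖h n‖ * (1 + |(n : ℝ)| ^ 2)
        = |(n : ℝ)| ^ k * ‖h n‖ + |(n : ℝ)| ^ (k + 2) * ‖h n‖ := by ring
    rw [e]
    exact add_le_add h0 h2
  have hB : |(n : ℝ)| ^ k * ‖h n‖ ≤
      (SchwartzMap.seminorm ℂ k 0 h + SchwartzMap.seminorm ℂ (k + 2) 0 h) *
        (1 + |(n : ℝ)| ^ 2)⁻¹ := by
    rw [← div_eq_mul_inv, le_div_iff₀ (by positivity)]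
    exact hA
  have hS : 0 ≤ (SchwartzMap.seminorm ℂ k 0 h + SchwartzMap.seminorm ℂ (k + 2) 0 h) *
      (1 + |(n : ℝ)| ^ 2)⁻¹ := le_trans (by positivity) hB
  calc ‖h n‖ * (2 * Real.pi * |(n : ℝ)|) ^ k
      = (2 * Real.pi) ^ k * (|(n : ℝ)| ^ k * ‖h n‖) := by rw [mul_pow]; ring
    _ ≤ (2 * Real.pi) ^ k * ((SchwartzMap.seminorm ℂ k 0 h +
          SchwartzMap.seminorm ℂ (k + 2) 0 h) * (1 + |(n : ℝ)| ^ 2)⁻¹ * 2) := by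
        refine mul_le_mul_of_nonneg_left ?_ (by positivity)
        linarith
    _ = _ := by ring

theorem contDiff_fourier_series (h : 𝓢(ℝ, ℂ)) :
    ContDiff ℝ ∞ (fun x : ℝ ↦ ∑' n : ℤ, h n * fourier n (x : UnitAddCircle)) := by
  refine contDiff_tsum (𝕜 := ℝ) (N := ⊤)
    (f := fun (n : ℤ) (x : ℝ) ↦ h n * fourier n (x : UnitAddCircle))
    (v := fun k (n : ℤ) ↦ ‖h n‖ * (2 * Real.pi * |(n : ℝ)|) ^ k)
    (fun n ↦ ?_) (fun k _ ↦ ?_) (fun k n x _ ↦ ?_)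
  · exact contDiff_const.mul (contDiff_fourier n)
  · exact Summable.of_nonneg_of_le (fun n ↦ by positivity) (fun n ↦ fourier_term_le h k n)
      ((summable_fourier_bound k).mul_left _)
  · rw [norm_iteratedFDeriv_eq_norm_iteratedDeriv, norm_iteratedDeriv_fourier_term]

theorem norm_iteratedDeriv_fourier_series_le (h : 𝓢(ℝ, ℂ)) (k : ℕ) (x : ℝ) :
    ‖iteratedDeriv k (fun x : ℝ ↦ ∑' n : ℤ, h n * fourier n (x : UnitAddCircle)) x‖ ≤
      (SchwartzMap.seminorm ℂ k 0 h + SchwartzMap.seminorm ℂ (k + 2) 0 h) *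
        ∑' n : ℤ, (2 * Real.pi) ^ k * (2 * (1 + |(n : ℝ)| ^ 2)⁻¹) := by
  have hs : ∀ k : ℕ, Summable fun n : ℤ ↦ ‖h n‖ * (2 * Real.pi * |(n : ℝ)|) ^ k :=
    fun k ↦ Summable.of_nonneg_of_le (fun n ↦ by positivity) (fun n ↦ fourier_term_le h k n)
      ((summable_fourier_bound k).mul_left _)
  have hd := iteratedFDeriv_tsum (𝕜 := ℝ) (N := ⊤)
      (f := fun (n : ℤ) (x : ℝ) ↦ h n * fourier n (x : UnitAddCircle))
      (v := fun k (n : ℤ) ↦ ‖h n‖ * (2 * Real.pi * |(n : ℝ)|) ^ k)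
      (fun n ↦ contDiff_const.mul (contDiff_fourier n)) (fun k _ ↦ hs k)
      (fun k n x _ ↦ by
        rw [norm_iteratedFDeriv_eq_norm_iteratedDeriv, norm_iteratedDeriv_fourier_term])
      (k := k) le_top
  rw [← norm_iteratedFDeriv_eq_norm_iteratedDeriv, hd, ← tsum_mul_left]
  refine tsum_of_norm_bounded ((summable_fourier_bound k).mul_left _).hasSum (fun n ↦ ?_)
  rw [norm_iteratedFDeriv_eq_norm_iteratedDeriv, norm_iteratedDeriv_fourier_term]
  exact fourier_term_le h k n

theorem tsum_schwartz_eq (ψ : 𝓢(ℝ, ℂ)) :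
    (fun x : ℝ ↦ ∑' n : ℤ, ψ (x + n)) =
      fun x : ℝ ↦ ∑' n : ℤ, (𝓕 ψ) n * fourier n (x : UnitAddCircle) :=
  funext fun x ↦ SchwartzMap.tsum_eq_tsum_fourier ψ x

theorem contDiff_tsum_schwartz (ψ : 𝓢(ℝ, ℂ)) :
    ContDiff ℝ ∞ (fun x : ℝ ↦ ∑' n : ℤ, ψ (x + n)) := by
  rw [tsum_schwartz_eq]
  exact contDiff_fourier_series (𝓕 ψ)

theorem norm_iteratedDeriv_tsum_schwartz_le (ψ : 𝓢(ℝ, ℂ)) (k : ℕ) (x : ℝ) :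
    ‖iteratedDeriv k (fun x : ℝ ↦ ∑' n : ℤ, ψ (x + n)) x‖ ≤
      (SchwartzMap.seminorm ℂ k 0 (𝓕 ψ) + SchwartzMap.seminorm ℂ (k + 2) 0 (𝓕 ψ)) *
        ∑' n : ℤ, (2 * Real.pi) ^ k * (2 * (1 + |(n : ℝ)| ^ 2)⁻¹) := by
  rw [tsum_schwartz_eq]
  exact norm_iteratedDeriv_fourier_series_le (𝓕 ψ) k x

/-- The periodization `x ↦ ∑ₙ ψ(x + n)` of a Schwartz function, as a test function on the
circle. -/
noncomputable def periodize (ψ : 𝓢(ℝ, ℂ)) : SmoothCircle :=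
  ⟨(periodic_tsum_schwartz ψ).lift, contDiff_tsum_schwartz ψ⟩

theorem periodize_coe (ψ : 𝓢(ℝ, ℂ)) (x : ℝ) :
    periodize ψ (x : UnitAddCircle) = ∑' n : ℤ, ψ (x + n) := rfl

theorem summable_schwartz_translates (ψ : 𝓢(ℝ, ℂ)) (x : ℝ) :
    Summable fun n : ℤ ↦ ψ (x + n) := by
  refine Summable.of_norm (Summable.of_nonneg_of_le (fun n ↦ norm_nonneg _) (fun n ↦ ?_)
    ((summable_fourier_bound 0).mul_left
      (SchwartzMap.seminorm ℂ 0 0 (SchwartzMap.compSubConstCLM ℂ (-x) ψ) +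
        SchwartzMap.seminorm ℂ (0 + 2) 0 (SchwartzMap.compSubConstCLM ℂ (-x) ψ))))
  have := fourier_term_le (SchwartzMap.compSubConstCLM ℂ (-x) ψ) 0 n
  simpa [add_comm] using this

/-- Periodization as a linear map. -/
noncomputable def periodizeLM : 𝓢(ℝ, ℂ) →ₗ[ℂ] SmoothCircle where
  toFun := periodize
  map_add' ψ χ := SmoothCircle.ext_fun fun x ↦
    (summable_schwartz_translates ψ x).tsum_add (summable_schwartz_translates χ x)
  map_smul' c ψ := SmoothCircle.ext_fun fun x ↦
    (summable_schwartz_translates ψ x).tsum_const_smul c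

theorem continuous_periodizeLM : Continuous periodizeLM := by
  refine SmoothCircle.withSeminorms_derivSeminorm.continuous_of_continuous_comp periodizeLM
    fun k ↦ Seminorm.continuous_of_continuousAt_zero ?_
  set C : ℝ := ∑' n : ℤ, (2 * Real.pi) ^ k * (2 * (1 + |(n : ℝ)| ^ 2)⁻¹)
  have hb : ∀ ψ : 𝓢(ℝ, ℂ), (SmoothCircle.derivSeminorm k).comp periodizeLM ψ ≤
      (SchwartzMap.seminorm ℂ k 0 (𝓕 ψ) + SchwartzMap.seminorm ℂ (k + 2) 0 (𝓕 ψ)) * C :=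
    fun ψ ↦ ciSup_le fun x ↦ norm_iteratedDeriv_tsum_schwartz_le ψ k x
  have hF : Continuous fun ψ : 𝓢(ℝ, ℂ) ↦ 𝓕 ψ :=
    (FourierTransform.fourierCLM ℂ 𝓢(ℝ, ℂ)).continuous
  have hs : ∀ m : ℕ, Continuous fun ψ : 𝓢(ℝ, ℂ) ↦ SchwartzMap.seminorm ℂ m 0 (𝓕 ψ) :=
    fun m ↦ ((schwartz_withSeminorms ℂ ℝ ℂ).continuous_seminorm (m, 0)).comp hF
  have hc : Continuous fun ψ : 𝓢(ℝ, ℂ) ↦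
      (SchwartzMap.seminorm ℂ k 0 (𝓕 ψ) + SchwartzMap.seminorm ℂ (k + 2) 0 (𝓕 ψ)) * C :=
    ((hs k).add (hs (k + 2))).mul continuous_const
  have h0 : 𝓕 (0 : 𝓢(ℝ, ℂ)) = 0 := (FourierTransform.fourierCLM ℂ 𝓢(ℝ, ℂ)).map_zero
  have ht := hc.tendsto 0
  simp only [h0, map_zero, add_zero, zero_mul] at ht
  rw [ContinuousAt, map_zero]
  exact squeeze_zero (fun ψ ↦ apply_nonneg _ _) hb ht

/-- Periodization as a continuous linear map from `𝓢(ℝ)` to `C^∞(𝕊¹)`. -/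
noncomputable def periodizeCLM : 𝓢(ℝ, ℂ) →L[ℂ] SmoothCircle :=
  ⟨periodizeLM, continuous_periodizeLM⟩

end Periodization

/-- The 1-periodic extension `f^per ∈ 𝓢'(ℝ)` of a distribution `f` on the circle, that is, the
pull-back of `f` along the projection `ℝ → ℝ / ℤ`: `⟨f^per, ψ⟩ = ⟨f, ∑ₙ ψ(· + n)⟩`. The two
theorems that follow say that it is 1-periodic and that it agrees with `f` on every open interval
of length one. -/
noncomputable def periodicExtension (f : CircleDistribution) : 𝓢'(ℝ, ℂ) :=
  ContinuousLinearMap.toPointwiseConvergenceCLM _ _ _ _ (f ∘L periodizeCLM)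

theorem periodicExtension_apply (f : CircleDistribution) (ψ : 𝓢(ℝ, ℂ)) :
    periodicExtension f ψ = f (periodize ψ) := rfl

theorem periodicExtension_translate (f : CircleDistribution) (ψ : 𝓢(ℝ, ℂ)) :
    periodicExtension f (SchwartzMap.compSubConstCLM ℂ 1 ψ) = periodicExtension f ψ := by
  simp only [periodicExtension_apply]
  congr 1
  refine SmoothCircle.ext_fun fun x ↦ ?_
  rw [periodize_coe, periodize_coe, ← (Equiv.addRight (1 : ℤ)).tsum_eq]
  refine tsum_congr fun n ↦ ?_
  simp only [Equiv.coe_addRight, SchwartzMap.compSubConstCLM_apply]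
  congr 1
  push_cast
  ring

theorem periodicExtension_eq_of_support (f : CircleDistribution) (a : ℝ) (ψ : 𝓢(ℝ, ℂ))
    (hψ : Function.support ψ ⊆ Set.Ioo a (a + 1)) (g : SmoothCircle)
    (hg : ∀ x ∈ Set.Ico a (a + 1), g (x : UnitAddCircle) = ψ x) :
    periodicExtension f ψ = f g := by
  rw [periodicExtension_apply]
  congr 1
  refine SmoothCircle.ext_fun fun x ↦ ?_
  obtain ⟨m, hm, -⟩ := existsUnique_add_zsmul_mem_Ico (one_pos : (0 : ℝ) < 1) x a
  rw [zsmul_one] at hm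
  have hx : ((x + (m : ℝ) : ℝ) : UnitAddCircle) = (x : UnitAddCircle) := by
    simp
  rw [periodize_coe, tsum_eq_single m, ← hg _ hm, hx]
  intro n hn
  by_contra h
  have h1 := hψ h
  have h2 : (n : ℝ) < m + 1 := by linarith [h1.2, hm.1]
  have h3 : (m : ℝ) < n + 1 := by linarith [h1.1, hm.2]
  have h2' : n < m + 1 := by exact_mod_cast h2
  have h3' : m < n + 1 := by exact_mod_cast h3
  omega

/-! ### Dyadic resolutions of unity and Besov spaces -/

/-- `φ₀` generates a dyadic resolution of unity: `φ₀ ∈ 𝓢(ℝ)` is real valued, equal to `1` on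
`|x| ≤ 1` and to `0` on `|x| ≥ 3/2`. -/
structure IsDyadicGenerator (φ₀ : 𝓢(ℝ, ℝ)) : Prop where
  eq_one : ∀ x : ℝ, |x| ≤ 1 → φ₀ x = 1
  eq_zero : ∀ x : ℝ, 3 / 2 ≤ |x| → φ₀ x = 0

/-- The dyadic resolution of unity generated by `φ₀`: `φ₀` itself for `j = 0`, and
`φ_j(x) = φ₀(2^{-j} x) - φ₀(2^{-j+1} x)` for `j ≥ 1`. -/
noncomputable def dyadicResolution (φ₀ : 𝓢(ℝ, ℝ)) (j : ℕ) (x : ℝ) : ℝ :=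
  if j = 0 then φ₀ x
  else φ₀ ((2 : ℝ) ^ (-(j : ℤ)) * x) - φ₀ ((2 : ℝ) ^ (-(j : ℤ) + 1) * x)

theorem hasTemperateGrowth_schwartz_scale (φ₀ : 𝓢(ℝ, ℝ)) (c : ℝ) :
    (fun x : ℝ ↦ φ₀ (c * x)).HasTemperateGrowth := by
  have h : (fun x : ℝ ↦ c * x).HasTemperateGrowth := by fun_prop
  exact φ₀.hasTemperateGrowth.comp h

/-- The functions `φ_j` are admissible multipliers of tempered distributions, so that
`TemperedDistribution.smulLeftCLM` below is the actual multiplication by `φ_j`. -/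
theorem hasTemperateGrowth_dyadicResolution (φ₀ : 𝓢(ℝ, ℝ)) (j : ℕ) :
    (fun ξ : ℝ ↦ (dyadicResolution φ₀ j ξ : ℂ)).HasTemperateGrowth := by
  have h : (dyadicResolution φ₀ j).HasTemperateGrowth := by
    unfold dyadicResolution
    split_ifs with hj
    · exact φ₀.hasTemperateGrowth
    · exact (hasTemperateGrowth_schwartz_scale φ₀ _).sub (hasTemperateGrowth_schwartz_scale φ₀ _)
  exact Function.Complex.hasTemperateGrowth_ofReal.comp h

/-- The dyadic block `(φ_j F̂)^∨` of a tempered distribution `F` on the line. -/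
noncomputable def dyadicBlock (φ₀ : 𝓢(ℝ, ℝ)) (j : ℕ) (F : 𝓢'(ℝ, ℂ)) : 𝓢'(ℝ, ℂ) :=
  𝓕⁻ (TemperedDistribution.smulLeftCLM ℂ (fun ξ : ℝ ↦ (dyadicResolution φ₀ j ξ : ℂ)) (𝓕 F))

/-- The essential supremum `ess sup |T(x)| ∈ [0, ∞]` of a tempered distribution `T`: it is
`ess sup |g(x)|` if `T` is given by a (necessarily unique) `g ∈ L^∞(ℝ)`, and `∞` if there is no
such `g`. -/
noncomputable def distributionEssSup (T : 𝓢'(ℝ, ℂ)) : ℝ≥0∞ :=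
  ⨅ (g : Lp ℂ ⊤ (volume : Measure ℝ)) (_ : Lp.toTemperedDistribution g = T),
    essSup (fun x : ℝ ↦ ‖g x‖ₑ) volume

/-- The quasi-norm `‖F‖_{∞,∞,φ,s} = sup_{j ≥ 0} 2^{js} ess sup_x |(φ_j F̂)^∨(x)|`, with values in
`[0, ∞]`, of a tempered distribution on the line. -/
noncomputable def besovNormLine (φ₀ : 𝓢(ℝ, ℝ)) (s : ℝ) (F : 𝓢'(ℝ, ℂ)) : ℝ≥0∞ :=
  ⨆ j : ℕ, ENNReal.ofReal ((2 : ℝ) ^ ((j : ℝ) * s)) * distributionEssSup (dyadicBlock φ₀ j F)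

/-- The Besov space `B^s_{∞,∞}(ℝ)`. -/
def besovSpaceLine (φ₀ : 𝓢(ℝ, ℝ)) (s : ℝ) : Set 𝓢'(ℝ, ℂ) :=
  {F | besovNormLine φ₀ s F < ⊤}

/-- The quasi-norm `sup_{j ≥ 0} 2^{js} ess sup_x |∑ₙ φ_j(n) f̂(n) e^{2πinx}|`, with values in
`[0, ∞]`, of a distribution on the circle. The sum over `n` has finitely many non-zero terms. -/
noncomputable def besovNormCircle (φ₀ : 𝓢(ℝ, ℝ)) (s : ℝ) (f : CircleDistribution) : ℝ≥0∞ :=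
  ⨆ j : ℕ, ENNReal.ofReal ((2 : ℝ) ^ ((j : ℝ) * s)) *
    essSup (fun x : ℝ ↦ ‖∑' n : ℤ, (dyadicResolution φ₀ j (n : ℝ) : ℂ) *
      circleFourierCoeff f n * fourier n (x : UnitAddCircle)‖ₑ) volume

/-- The Besov space `B^s_{∞,∞}(𝕊¹)`. -/
def besovSpaceCircle (φ₀ : 𝓢(ℝ, ℝ)) (s : ℝ) : Set CircleDistribution :=
  {f | besovNormCircle φ₀ s f < ⊤}

/-!
Poisson summation, `∑ₙ ψ(· + n) = ∑ₙ (𝓕 ψ)(n) e^{2πinx}`, converges in `C^∞(𝕊¹)`, so pairing it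
with `f` gives `𝓕 f^PER = ∑ₙ f̂(n) δₙ`, where `∑ₙ χ(n) f̂(n)` converges absolutely for every
Schwartz function `χ`. As every `φ_j` is a Schwartz function, Fubini's theorem shows that
`(φ_j 𝓕 f^PER)^∨` is the bounded continuous function `∑ₙ φ_j(n) f̂(n) e^{2πinx}`. The function in
`L^∞` representing a distribution is unique, hence the two norms agree block by block.
-/

theorem norm_fourier_apply (n : ℤ) (z : UnitAddCircle) : ‖fourier n z‖ = 1 := by
  rw [fourier_apply, Circle.norm_coe]

theorem norm_mul_fourier (c : ℂ) (n : ℤ) (z : UnitAddCircle) : ‖c * fourier n z‖ = ‖c‖ := by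
  rw [norm_mul, norm_fourier_apply, mul_one]

namespace SmoothCircle

theorem sum_smul_apply {ι : Type*} (S : Finset ι) (a : ι → ℂ) (g : ι → SmoothCircle)
    (z : UnitAddCircle) : (∑ i ∈ S, a i • g i) z = ∑ i ∈ S, a i * g i z := by
  classical
  induction S using Finset.induction_on with
  | empty => rfl
  | insert i S hi ih =>
    rw [Finset.sum_insert hi, Finset.sum_insert hi, ← ih]
    rfl

theorem derivSeminorm_le_of_eq_tsum_mul_fourier {ι : Type*} {a : ι → ℂ} {ν : ι → ℤ}
    {g : SmoothCircle} (ha : ∀ k : ℕ, Summable fun i ↦ ‖a i‖ * (2 * Real.pi * |(ν i : ℝ)|) ^ k)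
    (hg : ∀ x : ℝ, g x = ∑' i, a i * fourier (ν i) (x : UnitAddCircle)) (k : ℕ) :
    derivSeminorm k g ≤ ∑' i, ‖a i‖ * (2 * Real.pi * |(ν i : ℝ)|) ^ k := by
  have norm_deriv_term (k : ℕ) (i : ι) (x : ℝ) :
      ‖iteratedFDeriv ℝ k (fun y : ℝ ↦ a i * fourier (ν i) (y : UnitAddCircle)) x‖ =
        ‖a i‖ * (2 * Real.pi * |(ν i : ℝ)|) ^ k := by
    rw [norm_iteratedFDeriv_eq_norm_iteratedDeriv, norm_iteratedDeriv_fourier_term]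
  have deriv_series : iteratedFDeriv ℝ k g.lift = fun x ↦
      ∑' i, iteratedFDeriv ℝ k (fun y : ℝ ↦ a i * fourier (ν i) (y : UnitAddCircle)) x := by
    rw [show g.lift = _ from funext hg]
    exact iteratedFDeriv_tsum (N := ⊤) (fun i ↦ contDiff_const.mul (contDiff_fourier (ν i)))
      (fun k _ ↦ ha k) (fun k i x _ ↦ (norm_deriv_term k i x).le) le_top
  refine ciSup_le fun x ↦ ?_
  rw [← norm_iteratedFDeriv_eq_norm_iteratedDeriv, deriv_series]
  exact tsum_of_norm_bounded (ha k).hasSum fun i ↦ (norm_deriv_term k i x).le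

theorem hasSum_smul_char {a : ℤ → ℂ} {g : SmoothCircle}
    (ha : ∀ k : ℕ, Summable fun n : ℤ ↦ ‖a n‖ * (2 * Real.pi * |(n : ℝ)|) ^ k)
    (hg : ∀ x : ℝ, g x = ∑' n : ℤ, a n * fourier n (x : UnitAddCircle)) :
    HasSum (fun n ↦ a n • char n) g := by
  have summable_series (x : ℝ) : Summable fun n : ℤ ↦ a n * fourier n (x : UnitAddCircle) :=
    .of_norm <| by simpa only [norm_mul_fourier, pow_zero, mul_one] using ha 0
  have remainder_apply (S : Finset ℤ) (x : ℝ) : (g - ∑ n ∈ S, a n • char n) x =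
      ∑' n : {n // n ∉ S}, a n * fourier (n : ℤ) (x : UnitAddCircle) := by
    change g x - (∑ n ∈ S, a n • char n) x = _
    rw [hg, sum_smul_apply, ← (summable_series x).sum_add_tsum_subtype_compl S]
    exact add_sub_cancel_left _ _
  refine (withSeminorms_derivSeminorm.tendsto_nhds _ _).2 fun k ε hε ↦ ?_
  have tail_lt : ∀ᶠ S : Finset ℤ in Filter.atTop,
      ∑' n : {n // n ∉ S}, ‖a n‖ * (2 * Real.pi * |((n : ℤ) : ℝ)|) ^ k < ε :=
    (tendsto_tsum_compl_atTop_zero fun n : ℤ ↦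
      ‖a n‖ * (2 * Real.pi * |(n : ℝ)|) ^ k).eventually_lt_const hε
  filter_upwards [tail_lt] with S hS
  rw [map_sub_rev]
  exact (derivSeminorm_le_of_eq_tsum_mul_fourier (fun m ↦ (ha m).subtype _)
    (remainder_apply S) k).trans_lt hS

end SmoothCircle

theorem summable_norm_schwartz_mul_pow (χ : 𝓢(ℝ, ℂ)) (k : ℕ) :
    Summable fun n : ℤ ↦ ‖χ n‖ * (2 * Real.pi * |(n : ℝ)|) ^ k :=
  .of_nonneg_of_le (fun _ ↦ by positivity) (fourier_term_le χ k)
    ((summable_fourier_bound k).mul_left _)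

theorem hasSum_fourier_smul_char (ψ : 𝓢(ℝ, ℂ)) :
    HasSum (fun n : ℤ ↦ (𝓕 ψ) n • SmoothCircle.char n) (periodize ψ) :=
  SmoothCircle.hasSum_smul_char (summable_norm_schwartz_mul_pow (𝓕 ψ)) fun x ↦
    SchwartzMap.tsum_eq_tsum_fourier ψ x

theorem schwartz_fourier_fourier_apply {V E : Type*} [NormedAddCommGroup V] [InnerProductSpace ℝ V]
    [FiniteDimensional ℝ V] [MeasurableSpace V] [BorelSpace V] [NormedAddCommGroup E]
    [NormedSpace ℂ E] [CompleteSpace E] (χ : 𝓢(V, E)) (x : V) : 𝓕 (𝓕 χ) x = χ (-x) := by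
  have h : 𝓕⁻ (𝓕 χ) (-x) = χ (-x) := by rw [FourierTransform.fourierInv_fourier_eq]
  rw [← h, SchwartzMap.fourierInv_coe, Real.fourierInv_eq_fourier_neg, neg_neg,
    SchwartzMap.fourier_coe]

section FourierCoefficients

variable (f : CircleDistribution) (χ : 𝓢(ℝ, ℂ))

theorem hasSum_mul_circleFourierCoeff :
    HasSum (fun n : ℤ ↦ χ n * circleFourierCoeff f n) (𝓕 (periodicExtension f) χ) := by
  rw [TemperedDistribution.fourier_apply, periodicExtension_apply, ← (Equiv.neg ℤ).hasSum_iff]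
  simpa [Function.comp_def, schwartz_fourier_fourier_apply, circleFourierCoeff] using
    (hasSum_fourier_smul_char (𝓕 χ)).mapL f

theorem summable_mul_circleFourierCoeff : Summable fun n : ℤ ↦ χ n * circleFourierCoeff f n :=
  (hasSum_mul_circleFourierCoeff f χ).summable

end FourierCoefficients

section AbsolutelyConvergentSeries

variable {a : ℤ → ℂ}

theorem memLp_top_tsum_mul_fourier (ha : Summable a) :
    MemLp (fun x : ℝ ↦ ∑' n : ℤ, a n * fourier n (x : UnitAddCircle)) ⊤ volume := by
  have continuous_series : Continuous fun x : ℝ ↦ ∑' n : ℤ, a n * fourier n (x : UnitAddCircle) :=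
    continuous_tsum (fun n ↦ continuous_const.mul (contDiff_fourier n).continuous) ha.norm
      fun n x ↦ (norm_mul_fourier (a n) n x).le
  exact memLp_top_of_bound continuous_series.aestronglyMeasurable (∑' n, ‖a n‖) <|
    .of_forall fun x ↦ tsum_of_norm_bounded ha.norm.hasSum fun n ↦ (norm_mul_fourier (a n) n x).le

theorem integral_mul_fourier (u : ℝ → ℂ) (n : ℤ) :
    ∫ x : ℝ, u x * fourier n (x : UnitAddCircle) = 𝓕⁻ u (n : ℝ) := by
  rw [Real.fourierInv_eq']
  refine integral_congr_ae (.of_forall fun x ↦ ?_)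
  simp only [fourier_coe_apply, smul_eq_mul, mul_comm (u x)]
  congr 2
  simp only [RCLike.inner_apply, conj_trivial]
  push_cast
  ring

theorem hasSum_mul_fourierInv {u : ℝ → ℂ} (ha : Summable a) (hu : Integrable u) :
    HasSum (fun n : ℤ ↦ a n * 𝓕⁻ u (n : ℝ))
      (∫ x : ℝ, u x * ∑' n : ℤ, a n * fourier n (x : UnitAddCircle)) := by
  have norm_term (n : ℤ) (x : ℝ) :
      ‖u x * (a n * fourier n (x : UnitAddCircle))‖ = ‖u x‖ * ‖a n‖ := by
    rw [norm_mul, norm_mul_fourier]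
  have integrable_term (n : ℤ) :
      Integrable fun x : ℝ ↦ u x * (a n * fourier n (x : UnitAddCircle)) :=
    hu.mul_bdd (continuous_const.mul (contDiff_fourier n).continuous).aestronglyMeasurable <|
      .of_forall fun x ↦ (norm_mul_fourier (a n) n x).le
  have integral_term (n : ℤ) :
      ∫ x : ℝ, u x * (a n * fourier n (x : UnitAddCircle)) = a n * 𝓕⁻ u (n : ℝ) := by
    simp only [mul_left_comm _ (a n), integral_const_mul, integral_mul_fourier]
  have h := hasSum_integral_of_summable_integral_norm integrable_term <| by
    simpa only [norm_term, integral_mul_const] using ha.norm.mul_left _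
  simpa only [integral_term, tsum_mul_left] using h

end AbsolutelyConvergentSeries

theorem toTemperedDistribution_top_injective :
    Function.Injective fun g : Lp ℂ ⊤ (volume : Measure ℝ) ↦ Lp.toTemperedDistribution g :=
  LinearMap.ker_eq_bot.1 <|
    Lp.ker_toTemperedDistributionCLM_eq_bot (F := ℂ) (μ := (volume : Measure ℝ)) (p := ⊤)

theorem distributionEssSup_of_toTemperedDistribution_eq {T : 𝓢'(ℝ, ℂ)}
    {g : Lp ℂ ⊤ (volume : Measure ℝ)} (hg : Lp.toTemperedDistribution g = T) :
    distributionEssSup T = essSup (fun x ↦ ‖g x‖ₑ) volume :=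
  le_antisymm (iInf₂_le g hg) <| le_iInf₂ fun h hh ↦ by
    rw [toTemperedDistribution_top_injective (hh.trans hg.symm)]

theorem distributionEssSup_eq_essSup {T : 𝓢'(ℝ, ℂ)} {u : ℝ → ℂ} (hu : MemLp u ⊤ volume)
    (hT : ∀ ψ : 𝓢(ℝ, ℂ), T ψ = ∫ x : ℝ, ψ x * u x) :
    distributionEssSup T = essSup (fun x ↦ ‖u x‖ₑ) volume := by
  have toLp_eq : Lp.toTemperedDistribution (hu.toLp u) = T := by
    ext ψ
    rw [Lp.toTemperedDistribution_apply, hT]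
    exact integral_congr_ae (hu.coeFn_toLp.mono fun x hx ↦ by simp only [hx, smul_eq_mul])
  rw [distributionEssSup_of_toTemperedDistribution_eq toLp_eq]
  exact essSup_congr_ae (hu.coeFn_toLp.mono fun x hx ↦ by simp only [hx])

section FourierMultiplier

open TemperedDistribution (fourierMultiplierCLM)

variable (f : CircleDistribution) (χ : 𝓢(ℝ, ℂ))

theorem fourierMultiplierCLM_periodicExtension_apply (ψ : 𝓢(ℝ, ℂ)) :
    fourierMultiplierCLM ℂ χ (periodicExtension f) ψ = ∫ x : ℝ, ψ x *
      ∑' n : ℤ, χ n * circleFourierCoeff f n * fourier n (x : UnitAddCircle) := by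
  have line := hasSum_mul_circleFourierCoeff f (SchwartzMap.smulLeftCLM ℂ χ (𝓕⁻ ψ))
  have circle := hasSum_mul_fourierInv (summable_mul_circleFourierCoeff f χ) ψ.integrable
  refine line.unique (circle.congr_fun fun n ↦ ?_)
  rw [SchwartzMap.smulLeftCLM_apply_apply χ.hasTemperateGrowth, SchwartzMap.fourierInv_coe,
    smul_eq_mul]
  ring

theorem distributionEssSup_fourierMultiplierCLM_periodicExtension :
    distributionEssSup (fourierMultiplierCLM ℂ χ (periodicExtension f)) =
      essSup (fun x : ℝ ↦
        ‖∑' n : ℤ, χ n * circleFourierCoeff f n * fourier n (x : UnitAddCircle)‖ₑ) volume :=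
  distributionEssSup_eq_essSup (memLp_top_tsum_mul_fourier (summable_mul_circleFourierCoeff f χ))
    (fourierMultiplierCLM_periodicExtension_apply f χ)

end FourierMultiplier

theorem exists_schwartz_eq_comp_mul {E : Type*} [NormedAddCommGroup E] [NormedSpace ℝ E]
    (φ : 𝓢(ℝ, E)) {c : ℝ} (hc : c ≠ 0) : ∃ θ : 𝓢(ℝ, E), ∀ x, θ x = φ (c * x) :=
  ⟨SchwartzMap.compCLMOfContinuousLinearEquiv ℝ
    (ContinuousLinearEquiv.unitsEquivAut ℝ (Units.mk0 c hc)) φ, fun x ↦ by simp [mul_comm]⟩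

theorem exists_schwartz_eq_dyadicResolution (φ₀ : 𝓢(ℝ, ℝ)) (j : ℕ) :
    ∃ χ : 𝓢(ℝ, ℂ), ∀ x, χ x = (dyadicResolution φ₀ j x : ℂ) := by
  suffices ∃ θ : 𝓢(ℝ, ℝ), ∀ x, θ x = dyadicResolution φ₀ j x by
    obtain ⟨θ, hθ⟩ := this
    exact ⟨θ.postcompCLM Complex.ofRealCLM, fun x ↦ by simp [hθ]⟩
  unfold dyadicResolution
  split_ifs
  · exact ⟨φ₀, fun _ ↦ rfl⟩
  · obtain ⟨θ, hθ⟩ := exists_schwartz_eq_comp_mul φ₀ (c := 2 ^ (-(j : ℤ))) (by positivity)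
    obtain ⟨η, hη⟩ := exists_schwartz_eq_comp_mul φ₀ (c := 2 ^ (-(j : ℤ) + 1)) (by positivity)
    exact ⟨θ - η, fun x ↦ by rw [sub_apply, hθ, hη]⟩

theorem distributionEssSup_dyadicBlock_periodicExtension (φ₀ : 𝓢(ℝ, ℝ)) (j : ℕ)
    (f : CircleDistribution) :
    distributionEssSup (dyadicBlock φ₀ j (periodicExtension f)) =
      essSup (fun x : ℝ ↦ ‖∑' n : ℤ, (dyadicResolution φ₀ j (n : ℝ) : ℂ) *
        circleFourierCoeff f n * fourier n (x : UnitAddCircle)‖ₑ) volume := by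
  obtain ⟨χ, hχ⟩ := exists_schwartz_eq_dyadicResolution φ₀ j
  have h := distributionEssSup_fourierMultiplierCLM_periodicExtension f χ
  rw [show ⇑χ = _ from funext hχ] at h
  exact h

theorem mainTheorem3_general (φ₀ : 𝓢(ℝ, ℝ)) (s : ℝ) (f : CircleDistribution) :
    besovNormLine φ₀ s (periodicExtension f) = besovNormCircle φ₀ s f ∧
      (periodicExtension f ∈ besovSpaceLine φ₀ s ↔ f ∈ besovSpaceCircle φ₀ s) := by
  have norm_eq : besovNormLine φ₀ s (periodicExtension f) = besovNormCircle φ₀ s f :=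
    iSup_congr fun j ↦ by rw [distributionEssSup_dyadicBlock_periodicExtension]
  refine ⟨norm_eq, ?_⟩
  simp only [besovSpaceLine, besovSpaceCircle, Set.mem_ofPred_eq, norm_eq]

theorem mainTheorem3 (φ₀ : 𝓢(ℝ, ℝ)) (hφ₀ : IsDyadicGenerator φ₀) (s : ℝ)
    (f : CircleDistribution) :
    besovNormLine φ₀ s (periodicExtension f) = besovNormCircle φ₀ s f ∧
      (periodicExtension f ∈ besovSpaceLine φ₀ s ↔ f ∈ besovSpaceCircle φ₀ s) :=
  mainTheorem3_general φ₀ s f
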